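/- Let $K$ be a field of characteristic zero, let $k\ge 0$ and $n_1,\dots,n_k\ge 1$ be integers, put $s_j=n_1+\dots+n_{j-1}$ for $1\le j\le k$ (so $s_1=0$) and $n=1+n_1+\dots+n_k$. Let $N$ be the model nilpotent Lie algebra with basis $e_1,\dots,e_n$ and non-zero products $$[e_{s_j+i},e_1]=e_{s_j+i+1},\qquad 1\le j\le k,\ 2\le i\le n_j$$ (when $n_1\ge\dots\ge n_k$, its characteristic sequence is $(n_1,\dots,n_k,1)$). Let $L_{k+1}(N)$ be the solvable Lie algebra over $K$ with nilradical $N$ and complementary space of dimension $k+1$ given by a basis $x_1,\dots,x_{k+1},e_1,\dots,e_n$ and the products $$[e_{s_j+i},e_1]=e_{s_j+i+1}\quad(1\le j\le k,\ 2\le i\le n_j),$$ $$[e_m,x_1]=m\,e_m\quad(1\le m\le n),$$ $$[e_{s_j+i},x_{j+1}]=e_{s_j+i}\quad(1\le j\le k,\ 2\le i\le n_j+1),$$ all other products of basis vectors being zero, up to antisymmetry. A linear operator $\Delta$ on a Lie algebra $L$ is called a local derivation if for every $x\in L$ there is a derivation $d_x$ of $L$ with $\Delta(x)=d_x(x)$.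 Then every local derivation $\Delta$ of $L_{k+1}(N)$ is a derivation; moreover it is inner: there is $z\in L_{k+1}(N)$ such that $\Delta(y)=[y,z]$ for all $y\in L_{k+1}(N)$. -/

import Mathlib

namespace ModelSolvable

open Module

/-- Labels of the basis `x_1, …, x_{k+1}, e_1, …, e_n`, where `n = 1 + n_1 + … + n_k`.
The left summand labels the `x`'s (`x_1` by `0`, and `x_{j+1}` by `j.succ`); `none` labels `e_1`;
and `some ⟨j, i⟩` labels the `i`-th vector of the `j`-th Jordan block (with `i = 0, …, n_j - 1`),
that is `e_m` with `m = pos n j i`. -/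
abbrev Idx {k : ℕ} (n : Fin k → ℕ) : Type :=
  Fin (k + 1) ⊕ Option (Σ j : Fin k, Fin (n j))

/-- The label of `x_{j+1}`, `j = 0, …, k`. -/
abbrev xi {k : ℕ} (n : Fin k → ℕ) (j : Fin (k + 1)) : Idx n := Sum.inl j

/-- The label of `e_1`. -/
abbrev e₁ {k : ℕ} (n : Fin k → ℕ) : Idx n := Sum.inr none

/-- The label of the `i`-th vector of block `j` (both counted from `0`). -/
abbrev ei {k : ℕ} (n : Fin k → ℕ) (j : Fin k) (i : Fin (n j)) : Idx n := Sum.inr (some ⟨j, i⟩)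

/-- The number `m` such that the `i`-th vector of block `j` is `e_m`: it is
`n_1 + … + n_{j-1} + i` with `2 ≤ i ≤ n_j + 1` when `i` and `j` are counted as usual. -/
def pos {k : ℕ} (n : Fin k → ℕ) (j : Fin k) (i : ℕ) : ℕ :=
  (∑ l ∈ Finset.univ.filter (fun l : Fin k => l < j), n l) + i + 2

/-- The model nilpotent multiplication table on a family
`e_1` (labelled `none`), `e_2, …, e_n` (labelled `some ⟨j, i⟩`): the bracket with `e_1` on the
right shifts every block by one step and kills its last vector; omitted products vanish. -/
structure IsModelTable {k : ℕ} (n : Fin k → ℕ) {L : Type*} [LieRing L]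
    (e : Option (Σ j : Fin k, Fin (n j)) → L) : Prop where
  shift : ∀ (j : Fin k) (i : ℕ) (hi : i + 1 < n j),
    ⁅e (some ⟨j, ⟨i, Nat.lt_of_succ_lt hi⟩⟩), e none⁆ = e (some ⟨j, ⟨i + 1, hi⟩⟩)
  last : ∀ (j : Fin k) (i : Fin (n j)), (i : ℕ) + 1 = n j → ⁅e (some ⟨j, i⟩), e none⁆ = 0
  comm : ∀ p q : Σ j : Fin k, Fin (n j), ⁅e (some p), e (some q)⁆ = 0

/-- `b` is a basis `x_1, …, x_{k+1}, e_1, …, e_n` of the Lie algebra `L` in which the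
multiplication of `L` is the table of `L_{k+1}(N)`, where `N` is the model nilpotent Lie algebra
spanned by `e_1, …, e_n`, with blocks of lengths `n_1, …, n_k`. -/
structure IsMaxSolvable {k : ℕ} (n : Fin k → ℕ) {K L : Type*} [Field K] [LieRing L]
    [LieAlgebra K L] (b : Basis (Idx n) K L) : Prop where
  /-- the `e`'s multiply as in the model nilpotent Lie algebra -/
  model : IsModelTable n (fun p => b (Sum.inr p))
  /-- `[e_1, x_1] = e_1` -/
  e₁_x₁ : ⁅b (e₁ n), b (xi n 0)⁆ = b (e₁ n)
  /-- `[e_m, x_1] = m e_m` for `m ≥ 2` -/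
  e_x₁ : ∀ (j : Fin k) (i : Fin (n j)),
    ⁅b (ei n j i), b (xi n 0)⁆ = (pos n j i : K) • b (ei n j i)
  /-- `[e_1, x_{j+1}] = 0` for `1 ≤ j ≤ k` -/
  e₁_x : ∀ j : Fin k, ⁅b (e₁ n), b (xi n j.succ)⁆ = 0
  /-- `[e_m, x_{j+1}] = e_m` if `e_m` lies in the `j`-th block -/
  e_x_same : ∀ (j : Fin k) (i : Fin (n j)), ⁅b (ei n j i), b (xi n j.succ)⁆ = b (ei n j i)
  /-- `[e_m, x_{j+1}] = 0` if `e_m` lies in another block -/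
  e_x_other : ∀ (j j' : Fin k) (i : Fin (n j)), j ≠ j' → ⁅b (ei n j i), b (xi n j'.succ)⁆ = 0
  /-- the `x`'s commute -/
  x_x : ∀ j j' : Fin (k + 1), ⁅b (xi n j), b (xi n j')⁆ = 0

/-- A linear operator `Δ` is a local derivation if at every point it agrees with some derivation
(depending on the point). -/
def IsLocalDerivation {K L : Type*} [Field K] [LieRing L] [LieAlgebra K L]
    (Δ : L →ₗ[K] L) : Prop :=
  ∀ x : L, ∃ d : LieDerivation K L L, Δ x = d x

/-! The table does define a Lie algebra: coordinates, bracket, Jacobi identity. -/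

/-- The space of coordinate vectors with respect to `x_1, …, x_{k+1}, e_1, …, e_n`. -/
def Coord (K : Type*) {k : ℕ} (n : Fin k → ℕ) : Type _ := Idx n → K

variable {K : Type*} [Field K] {k : ℕ} {n : Fin k → ℕ}

noncomputable instance : AddCommGroup (Coord K n) := inferInstanceAs (AddCommGroup (Idx n → K))
noncomputable instance : Module K (Coord K n) := inferInstanceAs (Module K (Idx n → K))

/-- Coordinate of the predecessor in the block, `0` at the first vector. -/
def prev (u : Coord K n) (j : Fin k) : (i : ℕ) → i < n j → K
  | 0, _ => 0
  | i + 1, h => u (ei n j ⟨i, Nat.lt_of_succ_lt h⟩)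

/-- The bilinear extension of the table. -/
def brk (u v : Coord K n) : Coord K n
  | Sum.inl _ => 0
  | Sum.inr none => u (e₁ n) * v (xi n 0) - v (e₁ n) * u (xi n 0)
  | Sum.inr (some ⟨j, i⟩) =>
      (pos n j i : K) * (u (ei n j i) * v (xi n 0) - v (ei n j i) * u (xi n 0))
      + (u (ei n j i) * v (xi n j.succ) - v (ei n j i) * u (xi n j.succ))
      + (prev u j i i.2 * v (e₁ n) - prev v j i i.2 * u (e₁ n))

theorem coord_add (u v : Coord K n) (p : Idx n) : (u + v) p = u p + v p := rfl
theorem coord_smul (c : K) (v : Coord K n) (p : Idx n) : (c • v) p = c * v p := rfl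
theorem coord_zero (p : Idx n) : (0 : Coord K n) p = 0 := rfl

theorem prev_add (u v : Coord K n) (j : Fin k) (i : ℕ) (h : i < n j) :
    prev (u + v) j i h = prev u j i h + prev v j i h := by
  cases i <;> simp [prev, coord_add]

theorem prev_smul (c : K) (v : Coord K n) (j : Fin k) (i : ℕ) (h : i < n j) :
    prev (c • v) j i h = c * prev v j i h := by
  cases i <;> simp [prev, coord_smul]

noncomputable instance : LieRing (Coord K n) where
  bracket := brk
  add_lie u v w := by
    funext p
    rcases p with j | _ | ⟨j, i⟩ <;>
      simp only [brk, coord_add, prev_add] <;> ring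
  lie_add u v w := by
    funext p
    rcases p with j | _ | ⟨j, i⟩ <;>
      simp only [brk, coord_add, prev_add] <;> ring
  lie_self u := by
    funext p
    rcases p with j | _ | ⟨j, i⟩ <;>
      simp only [brk, coord_zero] <;> ring
  leibniz_lie u v w := by
    funext p
    rcases p with j | _ | ⟨j, ⟨i, hi⟩⟩
    · simp [brk, coord_add]
    · simp only [brk, coord_add]; ring
    · rcases i with _ | _ | i <;>
        simp only [brk, coord_add, prev, pos] <;> push_cast <;> ring

theorem lie_def (u v : Coord K n) : ⁅u, v⁆ = brk u v := rfl

noncomputable instance : LieAlgebra K (Coord K n) where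
  lie_smul c u v := by
    funext p
    rcases p with j | _ | ⟨j, i⟩ <;>
      simp only [lie_def, brk, coord_smul, prev_smul] <;> ring

/-- The standard basis of the coordinate space. -/
noncomputable def stdBasis (K : Type*) [Field K] {k : ℕ} (n : Fin k → ℕ) :
    Basis (Idx n) K (Coord K n) := Pi.basisFun K (Idx n)

theorem stdBasis_apply (p q : Idx n) : stdBasis K n p q = if q = p then 1 else 0 := by
  have : stdBasis K n p = (Pi.basisFun K (Idx n) p : Idx n → K) := rfl
  rw [this, Pi.basisFun_apply, Pi.single_apply]

/-- The standard basis multiplies by the table, so that `L_{k+1}(N)` exists over every field and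
for all block lengths. -/
theorem isMaxSolvable_stdBasis (K : Type*) [Field K] {k : ℕ} (n : Fin k → ℕ) :
    IsMaxSolvable n (stdBasis K n) := by
  refine ⟨⟨?_, ?_, ?_⟩, ?_, ?_, ?_, ?_, ?_, ?_⟩ <;> intros <;> funext p <;>
    rcases p with l | _ | ⟨l, ⟨_ | m, hm⟩⟩ <;>
    simp only [lie_def, brk, stdBasis_apply, prev, coord_zero, coord_smul] <;> grind

end ModelSolvable

/-! The torus spanned by the `x`'s acts diagonally on the nilradical, with pairwise distinct
weights; those of `x_1` are nonzero in characteristic zero. After an inner correction, a derivation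
sends `x_1` into the torus; distinct weights make it diagonal, and diagonal maps whose eigenvalues
respect the shift come from torus elements (`inner_of_diagonal`). So derivations are inner
(`inner_of_derivation`), and a local derivation is pointwise inner: `Δ y = [y, z]` with `z`
depending on `y`.

To make `z` uniform, correct `Δ` so that it kills the torus (`pointwise_tor`). Then `Δ v = Δ (t +
v)` for every torus element `t`, and `t` can be chosen to have weight zero at a prescribed position,
which removes the unknown coordinate of `z` there (`exists_translate`). This makes `Δ` diagonal
(`pointwise_e₁`, `pointwise_ev`) and its eigenvalues compatible with the shift (`pointwise_shift`).
-/

namespace ModelSolvable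

open Module

/-! ### Weights and inner maps in the coordinate model. -/

section Coordinates

variable {K : Type*} [Field K] {k : ℕ} {n : Fin k → ℕ}

/-- The weight of the basis vector labelled `p` under the element `∑ a, f a • x_{a+1}`. -/
def wt (n : Fin k → ℕ) (f : Fin (k + 1) → K) : Option (Σ j : Fin k, Fin (n j)) → K
  | none => f 0
  | some ⟨j, i⟩ => (pos n j i : K) * f 0 + f j.succ

/-- The element `∑ a, f a • x_{a+1}` of the torus. -/
def tor (n : Fin k → ℕ) (f : Fin (k + 1) → K) : Coord K n
  | Sum.inl a => f a
  | Sum.inr _ => 0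

/-- The torus part of a vector. -/
def torPart (v : Coord K n) : Fin (k + 1) → K := fun a => v (Sum.inl a)

/-- The basis vector `e_m` labelled by `p`. -/
noncomputable def ev (K : Type*) [Field K] (n : Fin k → ℕ)
    (p : Option (Σ j : Fin k, Fin (n j))) : Coord K n := stdBasis K n (Sum.inr p)

theorem coord_sub (u v : Coord K n) (p : Idx n) : (u - v) p = u p - v p := rfl
theorem coord_neg (u : Coord K n) (p : Idx n) : (-u) p = -u p := rfl

@[simp] theorem tor_inl (f : Fin (k + 1) → K) (a : Fin (k + 1)) :
    tor n f (Sum.inl a) = f a := rfl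
@[simp] theorem tor_inr (f : Fin (k + 1) → K) (p) : tor n f (Sum.inr p) = 0 := rfl
@[simp] theorem torPart_tor (f : Fin (k + 1) → K) : torPart (tor n f) = f := rfl

theorem torPart_add (u v : Coord K n) : torPart (u + v) = torPart u + torPart v := rfl
theorem torPart_sub (u v : Coord K n) : torPart (u - v) = torPart u - torPart v := rfl

@[simp] theorem ev_inl (p) (a : Fin (k + 1)) : ev K n p (Sum.inl a) = 0 := by
  simp [ev, stdBasis_apply]

theorem ev_inr (p q) : ev K n p (Sum.inr q) = if q = p then 1 else 0 := by
  simp [ev, stdBasis_apply]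

@[simp] theorem torPart_ev (p) : torPart (ev K n p) = 0 := by
  funext a; simp [torPart]

@[simp] theorem wt_zero (p) : wt n (0 : Fin (k + 1) → K) p = 0 := by
  rcases p with _ | ⟨j, i⟩ <;> simp [wt]

theorem wt_sub (f g : Fin (k + 1) → K) (p) : wt n (f - g) p = wt n f p - wt n g p := by
  rcases p with _ | ⟨j, i⟩ <;> simp [wt]; ring

theorem wt_smul (c : K) (f : Fin (k + 1) → K) (p) : wt n (c • f) p = c * wt n f p := by
  rcases p with _ | ⟨j, i⟩ <;> simp [wt]; ring

theorem tor_sub (f g : Fin (k + 1) → K) : tor n (f - g) = tor n f - tor n g := by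
  funext p; rcases p with a | p <;> simp [coord_sub]

theorem tor_smul (c : K) (f : Fin (k + 1) → K) : tor n (c • f) = c • tor n f := by
  funext p; rcases p with a | p <;> simp [coord_smul]

theorem pos_succ (j : Fin k) (i : ℕ) : pos n j (i + 1) = pos n j i + 1 := by
  simp only [pos]; ring

@[simp] theorem lie_inl (u v : Coord K n) (a : Fin (k + 1)) : ⁅u, v⁆ (Sum.inl a) = 0 := rfl

theorem lie_none (u v : Coord K n) : ⁅u, v⁆ (Sum.inr none) =
    u (Sum.inr none) * wt n (torPart v) none - v (Sum.inr none) * wt n (torPart u) none := rfl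

theorem lie_some (u v : Coord K n) (j : Fin k) (i : Fin (n j)) :
    ⁅u, v⁆ (Sum.inr (some ⟨j, i⟩)) =
      u (Sum.inr (some ⟨j, i⟩)) * wt n (torPart v) (some ⟨j, i⟩)
      - v (Sum.inr (some ⟨j, i⟩)) * wt n (torPart u) (some ⟨j, i⟩)
      + (prev u j i i.2 * v (Sum.inr none) - prev v j i i.2 * u (Sum.inr none)) := by
  simp only [lie_def, brk, wt, torPart]; ring

@[simp] theorem prev_tor (f : Fin (k + 1) → K) (j : Fin k) (i : ℕ) (h : i < n j) :
    prev (tor n f) j i h = 0 := by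
  cases i <;> simp [prev]

@[simp] theorem prev_ev_none (j : Fin k) (i : ℕ) (h : i < n j) :
    prev (ev K n none) j i h = 0 := by
  cases i <;> simp [prev, ev_inr]

theorem lie_tor (u : Coord K n) (f : Fin (k + 1) → K) (p) :
    ⁅u, tor n f⁆ (Sum.inr p) = wt n f p * u (Sum.inr p) := by
  rcases p with _ | ⟨j, i⟩
  · rw [lie_none]; simp; ring
  · rw [lie_some]; simp; ring

theorem tor_lie (u : Coord K n) (f : Fin (k + 1) → K) (p) :
    ⁅tor n f, u⁆ (Sum.inr p) = -(wt n f p * u (Sum.inr p)) := by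
  rw [← lie_skew, coord_neg, lie_tor]

theorem lie_tor_eq_smul (p) (f : Fin (k + 1) → K) :
    ⁅ev K n p, tor n f⁆ = wt n f p • ev K n p := by
  funext q
  rcases q with a | q
  · simp [coord_smul]
  · rw [lie_tor, coord_smul, ev_inr]; split_ifs with h <;> simp [h]

theorem tor_lie_tor (f g : Fin (k + 1) → K) : ⁅tor n f, tor n g⁆ = 0 := by
  funext q
  rcases q with a | q
  · simp [coord_zero]
  · simp [lie_tor, coord_zero]

theorem eq_tor (u : Coord K n) (h : ∀ p, u (Sum.inr p) = 0) : u = tor n (torPart u) := by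
  funext q
  rcases q with a | q
  · rfl
  · exact h q

theorem lie_ev_shift (j : Fin k) (i : ℕ) (hi : i + 1 < n j) :
    ⁅ev K n (some ⟨j, ⟨i, Nat.lt_of_succ_lt hi⟩⟩), ev K n none⁆ = ev K n (some ⟨j, ⟨i + 1, hi⟩⟩) :=
  (isMaxSolvable_stdBasis K n).model.shift j i hi

theorem stdBasis_inl (a : Fin (k + 1)) : stdBasis K n (Sum.inl a) = tor n (Pi.single a 1) := by
  funext q
  rcases q with b | q
  · simp [stdBasis_apply, Pi.single_apply]
  · simp [stdBasis_apply]

theorem wt_single_zero_ne_zero [CharZero K] (p) :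
    wt n (Pi.single 0 1 : Fin (k + 1) → K) p ≠ 0 := by
  rcases p with _ | ⟨j, i⟩
  · simp [wt]
  · simp only [wt, Pi.single_eq_same, mul_one, ne_eq]
    rw [Pi.single_eq_of_ne (Fin.succ_ne_zero j), add_zero]
    exact_mod_cast (by simp [pos] : pos n j i ≠ 0)

/-- Distinct basis vectors of the nilradical have distinct weights. -/
theorem exists_wt_ne [CharZero K] {p q : Option (Σ j : Fin k, Fin (n j))} (h : p ≠ q) :
    ∃ f : Fin (k + 1) → K, wt n f p ≠ wt n f q := by
  rcases p with _ | ⟨j, i⟩ <;> rcases q with _ | ⟨j', i'⟩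
  · exact absurd rfl h
  · exact ⟨Pi.single j'.succ 1, by simp [wt]⟩
  · exact ⟨Pi.single j.succ 1, by simp [wt]⟩
  · by_cases hj : j = j'
    · subst hj
      refine ⟨Pi.single 0 1, ?_⟩
      simp only [wt, Pi.single_eq_same, mul_one, ne_eq, add_left_inj, Nat.cast_inj]
      intro hp
      apply h
      have : i = i' := Fin.ext (by simp only [pos] at hp; omega)
      rw [this]
    · refine ⟨Pi.single j.succ 1, ?_⟩
      simp [wt, Ne.symm hj]

/-- The torus acts faithfully: `e_1` detects `f 0`, and the first vector of each nonempty block then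
detects its own component. -/
theorem eq_zero_of_wt_eq_zero (hn : ∀ j, 1 ≤ n j) (f : Fin (k + 1) → K)
    (h : ∀ p, wt n f p = 0) : f = 0 := by
  have h0 : f 0 = 0 := h none
  funext a
  refine Fin.cases h0 (fun j => ?_) a
  have := h (some ⟨j, ⟨0, hn j⟩⟩)
  simpa [wt, h0] using this

/-- A linear map that kills the torus and is diagonal on the nilradical, with eigenvalues
compatible with the shift, is inner. -/
theorem inner_of_diagonal (hn : ∀ j, 1 ≤ n j) (F : Coord K n →ₗ[K] Coord K n)
    (hF : ∀ f, F (tor n f) = 0) (β : Option (Σ j : Fin k, Fin (n j)) → K)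
    (hβ : ∀ p, F (ev K n p) = β p • ev K n p)
    (hs : ∀ (j : Fin k) (i : ℕ) (hi : i + 1 < n j), β (some ⟨j, ⟨i + 1, hi⟩⟩) =
      β (some ⟨j, ⟨i, Nat.lt_of_succ_lt hi⟩⟩) + β none) :
    ∃ z, ∀ y, F y = ⁅y, z⁆ := by
  -- Solve for the weights at `e_1` and at the first vector of each block; the shift relation
  -- propagates them along the block.
  let f : Fin (k + 1) → K :=
    Fin.cases (β none) (fun j => β (some ⟨j, ⟨0, hn j⟩⟩) - (pos n j 0 : K) * β none)
  have hf : ∀ p, wt n f p = β p := by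
    rintro (_ | ⟨j, i, hi⟩)
    · rfl
    · induction i with
      | zero => simp [wt, f]
      | succ i ih =>
        rw [hs j i hi, ← ih (Nat.lt_of_succ_lt hi)]
        simp only [wt, pos_succ, f, Fin.cases_zero]; push_cast; ring
  refine ⟨tor n f, fun y => ?_⟩
  have : F = -(LieAlgebra.ad K (Coord K n) (tor n f) : Coord K n →ₗ[K] Coord K n) := by
    refine (stdBasis K n).ext fun q => ?_
    rw [LinearMap.neg_apply, LieAlgebra.ad_apply, lie_skew]
    rcases q with a | q
    · rw [stdBasis_inl, hF, tor_lie_tor]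
    · exact (hβ q).trans (by rw [← hf q]; exact (lie_tor_eq_smul q f).symm)
  rw [this, LinearMap.neg_apply, LieAlgebra.ad_apply, lie_skew]

/-- Any value at `x_1` in the nilradical is attained by an inner derivation. -/
theorem exists_lie_x₁ [CharZero K] (u : Coord K n) :
    ∃ z : Coord K n, ∀ p, (u - ⁅tor n (Pi.single 0 (1 : K)), z⁆) (Sum.inr p) = 0 := by
  let z : Coord K n := fun q => match q with
    | Sum.inl _ => 0
    | Sum.inr p => -(u (Sum.inr p) / wt n (Pi.single 0 1) p)
  refine ⟨z, fun p => ?_⟩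
  have hz : z (Sum.inr p) = -(u (Sum.inr p) / wt n (Pi.single 0 1) p) := rfl
  rw [coord_sub, tor_lie, hz, mul_neg, mul_div_cancel₀ _ (wt_single_zero_ne_zero p)]
  ring

/-! ### Derivations are inner -/

theorem inner_of_derivation_x₁ [CharZero K] (hn : ∀ j, 1 ≤ n j)
    (d : LieDerivation K (Coord K n) (Coord K n))
    (h₁ : ∀ p, d (tor n (Pi.single 0 1)) (Sum.inr p) = 0) : ∃ z, ∀ y, d y = ⁅y, z⁆ := by
  -- Apply `d` to `[t, x_1] = 0`.
  have ht : ∀ f, d (tor n f) = tor n (torPart (d (tor n f))) := fun f => by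
    refine eq_tor _ fun p => ?_
    have h := congrFun (d.apply_lie_eq_sub (tor n f) (tor n (Pi.single 0 1))) (Sum.inr p)
    rw [tor_lie_tor, map_zero, coord_zero, coord_sub, tor_lie, tor_lie, h₁] at h
    have h3 : wt n (Pi.single 0 1) p * d (tor n f) (Sum.inr p) = 0 := by linear_combination -h
    exact (mul_eq_zero.1 h3).resolve_left (wt_single_zero_ne_zero p)
  -- Apply `d` to the eigenvector relation for `ev K n p`; comparing coordinates gives everything
  -- below.
  have key : ∀ p f, wt n f p • d (ev K n p) =
      wt n (torPart (d (tor n f))) p • ev K n p - ⁅tor n f, d (ev K n p)⁆ := fun p f => by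
    rw [← map_smul, ← lie_tor_eq_smul, d.apply_lie_eq_sub, ht f, lie_tor_eq_smul, torPart_tor]
  have hdiag : ∀ p, d (ev K n p) = d (ev K n p) (Sum.inr p) • ev K n p := fun p => by
    funext q
    rcases q with a | q
    · have h := congrFun (key p (Pi.single 0 1)) (Sum.inl a)
      simp only [coord_smul, coord_sub, lie_inl, ev_inl, mul_zero, sub_zero] at h ⊢
      exact (mul_eq_zero.1 h).resolve_left (wt_single_zero_ne_zero p)
    · rw [coord_smul, ev_inr]
      split_ifs with hq
      · rw [hq, mul_one]
      · obtain ⟨f, hf⟩ := exists_wt_ne (K := K) hq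
        have h := congrFun (key p f) (Sum.inr q)
        simp only [coord_smul, coord_sub, tor_lie, ev_inr, if_neg hq, mul_zero] at h ⊢
        have h3 : (wt n f q - wt n f p) * d (ev K n p) (Sum.inr q) = 0 := by
          linear_combination -h
        exact (mul_eq_zero.1 h3).resolve_left (sub_ne_zero.2 hf)
  refine inner_of_diagonal hn (d : Coord K n →ₗ[K] Coord K n) (fun f => ?_)
    (fun p => d (ev K n p) (Sum.inr p)) hdiag fun j i hi => ?_
  · have : torPart (d (tor n f)) = 0 := eq_zero_of_wt_eq_zero hn _ fun p => by
      have h := congrFun (key p f) (Sum.inr p)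
      simp only [coord_smul, coord_sub, tor_lie, ev_inr, if_true, mul_one] at h
      linear_combination -h
    change d (tor n f) = 0
    rw [ht f, this]
    funext q
    rcases q with a | q <;> rfl
  · have h := d.apply_lie_eq_add (ev K n (some ⟨j, ⟨i, Nat.lt_of_succ_lt hi⟩⟩)) (ev K n none)
    rw [hdiag (some ⟨j, ⟨i, Nat.lt_of_succ_lt hi⟩⟩), hdiag none, lie_smul, smul_lie,
      lie_ev_shift j i hi, ← add_smul] at h
    have h2 := congrFun h (Sum.inr (some ⟨j, ⟨i + 1, hi⟩⟩))
    rw [coord_smul, ev_inr, if_pos rfl, mul_one] at h2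
    rw [h2, add_comm]

/-- Every derivation is inner. -/
theorem inner_of_derivation [CharZero K] (hn : ∀ j, 1 ≤ n j)
    (d : LieDerivation K (Coord K n) (Coord K n)) : ∃ z, ∀ y, d y = ⁅y, z⁆ := by
  obtain ⟨z, hz⟩ := exists_lie_x₁ (d (tor n (Pi.single 0 1)))
  -- `ad z` brackets on the left, so adding it subtracts the right bracket with `z`.
  have happ : ∀ y, (d + LieDerivation.ad K (Coord K n) z) y = d y - ⁅y, z⁆ := fun y => by
    rw [LieDerivation.add_apply, LieDerivation.ad_apply_apply, ← lie_skew y z, sub_neg_eq_add]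
  obtain ⟨w, hw⟩ := inner_of_derivation_x₁ hn (d + LieDerivation.ad K (Coord K n) z)
    fun p => by rw [happ]; exact hz p
  refine ⟨z + w, fun y => ?_⟩
  rw [lie_add, ← hw, happ]; abel

/-! ### Pointwise inner maps are inner -/

/-- A torus element whose `x_1`-coordinate is `1` and which commutes with position `m` of
block `j`. -/
def annih (K : Type*) [Field K] (n : Fin k → ℕ) (j : Fin k) (m : ℕ) : Fin (k + 1) → K :=
  Fin.cases 1 fun _ => -(pos n j m : K)

theorem wt_annih_none (j : Fin k) (m : ℕ) : wt n (annih K n j m) none = 1 := rfl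

theorem wt_annih (j : Fin k) (m : ℕ) (i : Fin (n j)) :
    wt n (annih K n j m) (some ⟨j, i⟩) = (i : K) - m := by
  simp only [wt, annih, pos, Fin.cases_zero, Fin.cases_succ]; push_cast; ring

/-- Coordinates of `w` in block `j` vanish before position `m` if `[w, t + e_1]` has no
coordinates there. -/
theorem eq_zero_of_chain [CharZero K] (w : Coord K n) (j : Fin k) (m : ℕ) (r : ℕ) (hr : r ≤ m)
    (h : ∀ (i : ℕ) (hi : i < n j), i < r →
      w (Sum.inr (some ⟨j, ⟨i, hi⟩⟩)) * ((i : K) - m) + prev w j i hi = 0) :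
    ∀ (i : ℕ) (hi : i < n j), i < r → w (Sum.inr (some ⟨j, ⟨i, hi⟩⟩)) = 0 := by
  intro i
  induction i with
  | zero =>
    intro hi h0
    have := h 0 hi h0
    simp only [prev, add_zero] at this
    refine (mul_eq_zero.1 this).resolve_right (sub_ne_zero.2 ?_)
    exact_mod_cast (by omega : 0 ≠ m)
  | succ i ih =>
    intro hi h0
    have := h (i + 1) hi h0
    simp only [prev] at this
    rw [ih _ (by omega), add_zero] at this
    refine (mul_eq_zero.1 this).resolve_right (sub_ne_zero.2 ?_)
    exact_mod_cast (by omega : i + 1 ≠ m)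

theorem prev_eq_zero (w : Coord K n) (j : Fin k) (i : ℕ) (hi : i < n j)
    (h : ∀ (i' : ℕ) (hi' : i' < n j), i' < i → w (Sum.inr (some ⟨j, ⟨i', hi'⟩⟩)) = 0) :
    prev w j i hi = 0 := by
  cases i with
  | zero => rfl
  | succ i => exact h i _ (Nat.lt_succ_self i)

theorem pointwise_tor [CharZero K] (F : Coord K n →ₗ[K] Coord K n) (hF : ∀ y, ∃ z, F y = ⁅y, z⁆)
    (h₁ : ∀ p, F (tor n (Pi.single 0 1)) (Sum.inr p) = 0) (f : Fin (k + 1) → K) :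
    F (tor n f) = 0 := by
  funext q
  rcases q with a | p
  · obtain ⟨z, hz⟩ := hF (tor n f)
    rw [hz]; rfl
  · have hx := wt_single_zero_ne_zero (K := K) p
    set x : Fin (k + 1) → K := Pi.single 0 1
    -- This multiple of `x_1` makes the weight at `p` zero, so the bracket has no `p`-coordinate.
    obtain ⟨z, hz⟩ := hF (tor n (f - (wt n f p / wt n x p) • x))
    have h := congrFun hz (Sum.inr p)
    rw [tor_lie, wt_sub, wt_smul, div_mul_cancel₀ _ hx, tor_sub, tor_smul, map_sub, map_smul,
      coord_sub, coord_smul, h₁] at h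
    rw [coord_zero]
    linear_combination h

/-- A pointwise inner map killing the torus, evaluated through a torus translate. -/
theorem exists_translate (F : Coord K n →ₗ[K] Coord K n) (hF : ∀ y, ∃ z, F y = ⁅y, z⁆)
    (hT : ∀ f, F (tor n f) = 0) (f : Fin (k + 1) → K) (v : Coord K n) (hv : torPart v = 0) :
    ∃ z : Coord K n,
      F v (Sum.inr none) =
        v (Sum.inr none) * wt n (torPart z) none - z (Sum.inr none) * wt n f none ∧
      ∀ (j : Fin k) (i : Fin (n j)), F v (Sum.inr (some ⟨j, i⟩)) =
        v (Sum.inr (some ⟨j, i⟩)) * wt n (torPart z) (some ⟨j, i⟩)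
        - z (Sum.inr (some ⟨j, i⟩)) * wt n f (some ⟨j, i⟩)
        + (prev v j i i.2 * z (Sum.inr none) - prev z j i i.2 * v (Sum.inr none)) := by
  obtain ⟨z, hz⟩ := hF (tor n f + v)
  rw [map_add, hT, zero_add] at hz
  refine ⟨z, ?_, fun j i => ?_⟩
  · rw [hz, lie_none, torPart_add, hv, torPart_tor, add_zero, coord_add, tor_inr, zero_add]
  · rw [hz, lie_some, torPart_add, hv, torPart_tor, add_zero, coord_add, coord_add, tor_inr,
      tor_inr, prev_add, prev_tor]
    simp only [zero_add]

/-- Induct along a block. Once the earlier coordinates of the image vanish, the chain forces those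
of `z` to vanish too; at position `i` the translate has weight zero, so nothing remains. -/
theorem pointwise_e₁ [CharZero K] (F : Coord K n →ₗ[K] Coord K n)
    (hF : ∀ y, ∃ z, F y = ⁅y, z⁆) (hT : ∀ f, F (tor n f) = 0) :
    F (ev K n none) = F (ev K n none) (Sum.inr none) • ev K n none := by
  funext q
  rcases q with a | _ | ⟨j, i, hi⟩
  · obtain ⟨z, hz⟩ := hF (ev K n none)
    rw [coord_smul, hz]; simp
  · rw [coord_smul, ev_inr, if_pos rfl, mul_one]
  · rw [coord_smul, ev_inr, if_neg (by simp), mul_zero]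
    induction i using Nat.strong_induction_on with
    | _ i ih =>
      obtain ⟨z, -, hz⟩ := exists_translate F hF hT (annih K n j i) (ev K n none) (torPart_ev _)
      have hz' : ∀ (i' : ℕ) (hi' : i' < n j), F (ev K n none) (Sum.inr (some ⟨j, ⟨i', hi'⟩⟩)) =
          -(z (Sum.inr (some ⟨j, ⟨i', hi'⟩⟩)) * ((i' : K) - i) + prev z j i' hi') :=
        fun i' hi' => by
          rw [hz, wt_annih, ev_inr, ev_inr, if_neg (by simp), if_pos rfl, prev_ev_none]
          ring
      have h0 := eq_zero_of_chain z j i i le_rfl fun i' hi' hlt => by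
        rw [← neg_eq_zero, ← hz' i' hi', ih i' hlt]
      rw [hz', prev_eq_zero z j i hi h0, sub_self, mul_zero, add_zero, neg_zero]

theorem pointwise_ev (F : Coord K n →ₗ[K] Coord K n)
    (hF : ∀ y, ∃ z, F y = ⁅y, z⁆) (hT : ∀ f, F (tor n f) = 0) (p : Σ j : Fin k, Fin (n j)) :
    F (ev K n (some p)) = F (ev K n (some p)) (Sum.inr (some p)) • ev K n (some p) := by
  have hv : ev K n (some p) (Sum.inr none) = 0 := by rw [ev_inr, if_neg (by simp)]
  have hnone : F (ev K n (some p)) (Sum.inr none) = 0 := by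
    obtain ⟨z, hz, -⟩ := exists_translate F hF hT 0 (ev K n (some p)) (torPart_ev _)
    rw [hz, wt_zero, hv]; ring
  funext q
  rcases q with a | _ | ⟨j, i⟩
  · obtain ⟨z, hz⟩ := hF (ev K n (some p))
    rw [coord_smul, hz]; simp
  · rw [hnone, coord_smul, hv, mul_zero]
  · by_cases hq : (⟨j, i⟩ : Σ j : Fin k, Fin (n j)) = p
    · rw [hq, coord_smul, ev_inr, if_pos rfl, mul_one]
    · have hq' : ev K n (some p) (Sum.inr (some ⟨j, i⟩)) = 0 := by
        rw [ev_inr, if_neg (by simpa using hq)]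
      obtain ⟨z, hz0, hz⟩ :=
        exists_translate F hF hT (annih K n j i) (ev K n (some p)) (torPart_ev _)
      rw [hnone, hv, wt_annih_none] at hz0
      -- The translate has weight `1` at `e_1`, which forces this and excludes a contribution from
      -- the shift.
      have hz1 : z (Sum.inr none) = 0 := by linear_combination hz0
      rw [hz, coord_smul, hq', hv, hz1, wt_annih]; ring

theorem pointwise_shift [CharZero K] (F : Coord K n →ₗ[K] Coord K n)
    (hF : ∀ y, ∃ z, F y = ⁅y, z⁆) (hT : ∀ f, F (tor n f) = 0)
    (β : Option (Σ j : Fin k, Fin (n j)) → K) (hβ : ∀ p, F (ev K n p) = β p • ev K n p)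
    (j : Fin k) (i : ℕ) (hi : i + 1 < n j) :
    β (some ⟨j, ⟨i + 1, hi⟩⟩) = β (some ⟨j, ⟨i, Nat.lt_of_succ_lt hi⟩⟩) + β none := by
  have hi' := Nat.lt_of_succ_lt hi
  -- With weights `-1`, `0`, `1` at positions `i`, `i + 1` and at `e_1`, these signs make both the
  -- `i`-th and the `e_1`-coordinate of `z` cancel when the three equations are added.
  set v : Coord K n :=
    ev K n none + ev K n (some ⟨j, ⟨i, hi'⟩⟩) - ev K n (some ⟨j, ⟨i + 1, hi⟩⟩) with hv
  have hcoord : ∀ q, v (Sum.inr q) = (if q = none then 1 else 0)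
      + (if q = some ⟨j, ⟨i, hi'⟩⟩ then 1 else 0)
      - (if q = some ⟨j, ⟨i + 1, hi⟩⟩ then 1 else 0) := fun q => by
    rw [hv, coord_sub, coord_add, ev_inr, ev_inr, ev_inr]
  have hFcoord : ∀ q, F v (Sum.inr q) = β q * v (Sum.inr q) := fun q => by
    rw [hv, map_sub, map_add, hβ, hβ, hβ]
    simp only [coord_sub, coord_add, coord_smul, ev_inr]
    split_ifs <;> simp_all
  have v0 : v (Sum.inr none) = 1 := by simp [hcoord]
  have v1 : v (Sum.inr (some ⟨j, ⟨i, hi'⟩⟩)) = 1 := by simp [hcoord]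
  have v2 : v (Sum.inr (some ⟨j, ⟨i + 1, hi⟩⟩)) = -1 := by simp [hcoord]
  have vlt : ∀ (m : ℕ) (hm : m < n j), m < i → v (Sum.inr (some ⟨j, ⟨m, hm⟩⟩)) = 0 :=
    fun m hm hlt => by
      rw [hcoord]
      simp [hlt.ne, (Nat.lt_succ_of_lt hlt).ne]
  obtain ⟨z, hz0, hz⟩ := exists_translate F hF hT (annih K n j (i + 1)) v
    (by rw [hv, torPart_sub, torPart_add]; simp)
  have hzero := eq_zero_of_chain z j (i + 1) i (Nat.le_succ i) fun m hm hlt => by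
    have h := hz j ⟨m, hm⟩
    rw [hFcoord, vlt m hm hlt, v0, wt_annih,
      prev_eq_zero v j m hm fun m' hm' hlt' => vlt m' hm' (hlt'.trans hlt)] at h
    push_cast at h ⊢
    linear_combination h
  have e1 := hz j ⟨i, hi'⟩
  have e2 := hz j ⟨i + 1, hi⟩
  have p1 : prev v j (i + 1) hi = 1 := v1
  have p2 : prev z j (i + 1) hi = z (Sum.inr (some ⟨j, ⟨i, hi'⟩⟩)) := rfl
  rw [hFcoord, v1, v0, wt_annih, prev_eq_zero v j i hi' vlt, prev_eq_zero z j i hi' hzero] at e1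
  rw [hFcoord, v2, v0, wt_annih, p1, p2] at e2
  rw [hFcoord, v0, wt_annih_none] at hz0
  simp only [wt, pos_succ] at e1 e2 hz0
  push_cast at e1 e2
  linear_combination -e1 - e2 - hz0

/-- A linear map that agrees with an inner derivation at every point is inner. -/
theorem inner_of_pointwise [CharZero K] (hn : ∀ j, 1 ≤ n j) (F : Coord K n →ₗ[K] Coord K n)
    (hF : ∀ y, ∃ z, F y = ⁅y, z⁆) : ∃ z, ∀ y, F y = ⁅y, z⁆ := by
  obtain ⟨z, hz⟩ := exists_lie_x₁ (F (tor n (Pi.single 0 1)))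
  let G : Coord K n →ₗ[K] Coord K n := F + LieAlgebra.ad K (Coord K n) z
  have happ : ∀ y, G y = F y - ⁅y, z⁆ := fun y => by
    rw [LinearMap.add_apply, LieAlgebra.ad_apply, ← lie_skew y z, sub_neg_eq_add]
  have hG : ∀ y, ∃ w, G y = ⁅y, w⁆ := fun y => by
    obtain ⟨w, hw⟩ := hF y
    exact ⟨w - z, by rw [happ, hw, lie_sub]⟩
  have hT := pointwise_tor G hG fun p => by rw [happ]; exact hz p
  have hβ : ∀ p, G (ev K n p) = G (ev K n p) (Sum.inr p) • ev K n p := by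
    rintro (_ | p)
    · exact pointwise_e₁ G hG hT
    · exact pointwise_ev G hG hT p
  obtain ⟨w, hw⟩ := inner_of_diagonal hn G hT (fun p => G (ev K n p) (Sum.inr p)) hβ
    (pointwise_shift G hG hT _ hβ)
  refine ⟨z + w, fun y => ?_⟩
  rw [lie_add, ← hw, happ]; abel

end Coordinates

/-! ### Transfer to an arbitrary algebra with the same table. -/

section Transfer

variable {K : Type*} [Field K] {k : ℕ} {n : Fin k → ℕ} {L M : Type*} [LieRing L] [LieAlgebra K L]
  [LieRing M] [LieAlgebra K M]

/-- The table determines the bracket: the linear map matching two bases with the same table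
preserves brackets. -/
theorem IsMaxSolvable.map_lie {b : Basis (Idx n) K L} (hb : IsMaxSolvable n b)
    {c : Basis (Idx n) K M} (hc : IsMaxSolvable n c) (x y : L) :
    b.equiv c (Equiv.refl _) ⁅x, y⁆ =
      ⁅b.equiv c (Equiv.refl _) x, b.equiv c (Equiv.refl _) y⁆ := by
  set φ := b.equiv c (Equiv.refl _) with hφ
  have hφb : ∀ p, φ (b p) = c p := fun p => by simp [hφ]
  have skew : ∀ p q, φ ⁅b p, b q⁆ = ⁅c p, c q⁆ → φ ⁅b q, b p⁆ = ⁅c q, c p⁆ := fun p q h => by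
    rw [← lie_skew, map_neg, h, lie_skew]
  have he₁ : ∀ (j : Fin k) (i : Fin (n j)),
      φ ⁅b (ei n j i), b (e₁ n)⁆ = ⁅c (ei n j i), c (e₁ n)⁆ := by
    rintro j ⟨i, hi⟩
    by_cases h : i + 1 < n j
    · exact ((congrArg φ (hb.model.shift j i h)).trans (hφb _)).trans (hc.model.shift j i h).symm
    · have h' : i + 1 = n j := by omega
      exact ((congrArg φ (hb.model.last j ⟨i, hi⟩ h')).trans (map_zero φ)).trans
        (hc.model.last j ⟨i, hi⟩ h').symm
  have hx : ∀ p a, φ ⁅b (Sum.inr p), b (xi n a)⁆ = ⁅c (Sum.inr p), c (xi n a)⁆ := by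
    rintro (_ | ⟨j, i⟩) a
    · refine Fin.cases ?_ (fun j => ?_) a
      · rw [hb.e₁_x₁, hc.e₁_x₁, hφb]
      · rw [hb.e₁_x, hc.e₁_x, map_zero]
    · refine Fin.cases ?_ (fun j' => ?_) a
      · rw [hb.e_x₁, hc.e_x₁, map_smul, hφb]
      · by_cases h : j = j'
        · subst h
          rw [hb.e_x_same, hc.e_x_same, hφb]
        · rw [hb.e_x_other j j' i h, hc.e_x_other j j' i h, map_zero]
  have key : ∀ p q, φ ⁅b p, b q⁆ = ⁅c p, c q⁆ := by
    rintro (a | p) (a' | q)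
    · rw [hb.x_x, hc.x_x, map_zero]
    · exact skew _ _ (hx q a)
    · exact hx p a'
    · rcases p with _ | p <;> rcases q with _ | q
      · rw [lie_self, lie_self, map_zero]
      · exact skew _ _ (he₁ q.1 q.2)
      · exact he₁ p.1 p.2
      · exact ((congrArg φ (hb.model.comm p q)).trans (map_zero φ)).trans (hc.model.comm p q).symm
  -- Both sides are bilinear, so agreement on pairs of basis vectors suffices.
  have hbil : ((LieModule.toEnd K L L : L →ₗ[K] Module.End K L).compr₂ (φ : L →ₗ[K] M)) =
      (LieModule.toEnd K M M : M →ₗ[K] Module.End K M).compl₁₂ (φ : L →ₗ[K] M) φ := by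
    refine b.ext fun p => b.ext fun q => ?_
    simpa [hφb] using key p q
  simpa using LinearMap.congr_fun₂ hbil x y

/-- Conjugation of a derivation by a Lie algebra isomorphism. -/
def conjDerivation (φ : L ≃ₗ⁅K⁆ M) (d : LieDerivation K L L) : LieDerivation K M M where
  toLinearMap := (φ : L →ₗ[K] M) ∘ₗ (d : L →ₗ[K] L) ∘ₗ (φ.symm : M →ₗ[K] L)
  leibniz' x y := by simp [LieEquiv.map_lie]

theorem conjDerivation_apply (φ : L ≃ₗ⁅K⁆ M) (d : LieDerivation K L L) (x : M) :
    conjDerivation φ d x = φ (d (φ.symm x)) := rfl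

end Transfer

end ModelSolvable

open ModelSolvable in
theorem theorem4p3 {K : Type*} [Field K] [CharZero K] {k : ℕ} (n : Fin k → ℕ)
    (hn : ∀ j, 1 ≤ n j) {L : Type*} [LieRing L] [LieAlgebra K L]
    (b : Module.Basis (ModelSolvable.Idx n) K L) (hb : ModelSolvable.IsMaxSolvable n b)
    (Δ : L →ₗ[K] L) (hΔ : ModelSolvable.IsLocalDerivation Δ) :
    (∃ D : LieDerivation K L L, ∀ y : L, D y = Δ y) ∧ ∃ z : L, ∀ y : L, Δ y = ⁅y, z⁆ := by
  let φ : L ≃ₗ⁅K⁆ Coord K n :=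
    { b.equiv (stdBasis K n) (Equiv.refl _) with
      map_lie' := fun {x y} => hb.map_lie (isMaxSolvable_stdBasis K n) x y }
  let F : Coord K n →ₗ[K] Coord K n :=
    (φ : L →ₗ[K] Coord K n) ∘ₗ Δ ∘ₗ (φ.symm : Coord K n →ₗ[K] L)
  have hF : ∀ y, F y = φ (Δ (φ.symm y)) := fun _ => rfl
  obtain ⟨w, hw⟩ := inner_of_pointwise hn F fun y => by
    obtain ⟨d, hd⟩ := hΔ (φ.symm y)
    obtain ⟨z, hz⟩ := inner_of_derivation hn (conjDerivation φ d)
    exact ⟨z, by rw [hF, hd, ← conjDerivation_apply, hz]⟩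
  have hz : ∀ y : L, Δ y = ⁅y, φ.symm w⁆ := fun y => by
    apply φ.injective
    change φ (Δ y) = φ ⁅y, φ.symm w⁆
    rw [LieEquiv.map_lie, φ.apply_symm_apply, ← hw, hF, φ.symm_apply_apply]
  refine ⟨⟨-LieDerivation.ad K L (φ.symm w), fun y => ?_⟩, φ.symm w, hz⟩
  rw [LieDerivation.neg_apply, LieDerivation.ad_apply_apply, lie_skew, hz]
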